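/- Let $W:[0,1]^2\to[0,1]$ be a graphon, i.e. a symmetric Lebesgue-measurable function. For $N\ge 2$ let $\mathrm{A}_d^N\in\mathbb{R}^{N\times N}$ be the matrix with entries $W(\tfrac iN,\tfrac jN)$ for $i\ne j$ and $0$ for $i=j$ ($1\le i,j\le N$), and let $\mathrm{A}_r^N=[\xi_{i,j}^N]$ be a random symmetric matrix with entries in $\{0,1\}$ and $\xi_{i,i}^N=0$, whose entries $\xi_{i,j}^N$ with $i>j$ are independent with $\mathbb{P}(\xi_{i,j}^N=1)=1-\mathbb{P}(\xi_{i,j}^N=0)=W(\tfrac iN,\tfrac jN)$. Define the combinatorial graph Laplacians $\mathrm{L}_d^N=\mathrm{A}_d^N-\mathrm{Deg}(\mathrm{A}_d^N)$ and $\mathrm{L}_r^N=\mathrm{A}_r^N-\mathrm{Deg}(\mathrm{A}_r^N)$, where $\mathrm{Deg}(\mathrm{A})$ is the diagonal matrix of row sums of $\mathrm{A}$, and let $\|M\|=\sup_{\|x\|_2=1}\|Mx\|_2$ be the operator norm with respect to the Euclidean norm. Then for every $\gamma\in(0,\tfrac12)$ there is a constant $C=C(\gamma)>0$, depending only on $\gamma$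 (in particular not on $N$ or $W$), such that for every graphon $W$ and every $N\ge 2$ $$\mathbb{P}\bigl(\|\mathrm{L}_r^N-\mathrm{L}_d^N\|\ge N^{\frac12+\gamma}\bigr)\le 2N\,\mathrm{e}^{-CN^{2\gamma}}.$$ -/

import Mathlib

open MeasureTheory ProbabilityTheory

/-- A graphon: a symmetric Lebesgue-measurable function `W : [0,1]² → [0,1]`.
`NullMeasurable` for the (Borel) volume is measurability with respect to its completion,
that is, Lebesgue measurability. -/
structure Graphon where
  toFun : unitInterval → unitInterval → unitInterval
  symm : ∀ x y, toFun x y = toFun y x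
  measurable : NullMeasurable (fun p : unitInterval × unitInterval => toFun p.1 p.2) volume

/-- The node `j / N ∈ [0,1]`, `j = 1, …, N`; the index `i : Fin N` stands for `j = i + 1`. -/
noncomputable def gridPoint (N : ℕ) (i : Fin N) : unitInterval :=
  ⟨((i : ℝ) + 1) / N, by
    have h : ((i : ℕ) : ℝ) + 1 ≤ N := by exact_mod_cast i.isLt
    exact ⟨by positivity, div_le_one_of_le₀ h (Nat.cast_nonneg N)⟩⟩

/-- The diagonal degree matrix, whose entries are the row sums of `A`. -/
def degMatrix {N : ℕ} (A : Matrix (Fin N) (Fin N) ℝ) : Matrix (Fin N) (Fin N) ℝ :=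
  Matrix.diagonal fun i => ∑ j, A i j

/-- The combinatorial graph Laplacian, with the sign convention `L = A - Deg A`. -/
def graphLaplacian {N : ℕ} (A : Matrix (Fin N) (Fin N) ℝ) : Matrix (Fin N) (Fin N) ℝ :=
  A - degMatrix A

/-- The weighted adjacency matrix of the deterministic graph with `N` vertices. -/
noncomputable def detAdjacency (W : Graphon) (N : ℕ) : Matrix (Fin N) (Fin N) ℝ :=
  Matrix.of fun i j => if i = j then 0 else (W.toFun (gridPoint N i) (gridPoint N j) : ℝ)

/-- `A` is the adjacency matrix of the random graph with `N` vertices generated by `W`,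
realized on the probability space `(Ω, P)`: symmetric, with values in `{0,1}`, zero on the
diagonal, with independent entries below the diagonal, the `(i,j)` entry being `1` with
probability `W(i/N, j/N)`. -/
structure IsRandomAdjacency {Ω : Type*} [MeasurableSpace Ω] (P : Measure Ω)
    (W : Graphon) (N : ℕ) (A : Ω → Matrix (Fin N) (Fin N) ℝ) : Prop where
  measurable : ∀ i j, Measurable fun ω => A ω i j
  zero_or_one : ∀ ω i j, A ω i j = 0 ∨ A ω i j = 1
  symm : ∀ ω i j, A ω i j = A ω j i
  diag : ∀ ω i, A ω i i = 0
  prob : ∀ i j, j < i →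
    P {ω | A ω i j = 1} = ENNReal.ofReal (W.toFun (gridPoint N i) (gridPoint N j) : ℝ)
  indep : iIndepFun
    (fun (e : {e : Fin N × Fin N // e.2 < e.1}) ω => A ω e.1.1 e.1.2) P

/-- The operator norm `sup_{‖x‖₂ = 1} ‖M x‖₂` for the Euclidean norm on `ℝ^N`. -/
noncomputable def opNorm {N : ℕ} (M : Matrix (Fin N) (Fin N) ℝ) : ℝ :=
  ‖Matrix.toEuclideanCLM (n := Fin N) (𝕜 := ℝ) M‖

/-! With `B = A ω - detAdjacency W N`, the Laplacian difference is `B` minus its degree matrix, and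
each is shown to have norm below half the threshold. Both bounds rest on one tail estimate,
`measureReal_le_dotProduct_le`: a bilinear form `y ⬝ᵥ B *ᵥ z` is a weighted sum of independent
centred entries, so Hoeffding applies. For `B` a union bound runs over pairs from a net of at most
`5 ^ N` points; for the degree matrix, whose norm is the largest absolute row sum, over `N` rows and
two signs. With `u = N ^ (2γ)`, the net costs `25 ^ N` against `exp (-N u / 256)`, which wins once
`u` is large; for bounded `u` the claim is trivial. Hence one `C` serves all `γ`. -/

open scoped Matrix

/-! ### Concentration of bilinear forms. -/

/-- A double sum over `Fin N` splits into the pairs below, above and on the diagonal. -/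
theorem sum_sum_eq_sum_lt_add_sum_diag {N : ℕ} (f : Fin N → Fin N → ℝ) :
    ∑ i, ∑ j, f i j =
      ∑ e : {e : Fin N × Fin N // e.2 < e.1}, (f e.1.1 e.1.2 + f e.1.2 e.1.1) + ∑ i, f i i := by
  have hsub : ∀ g : Fin N × Fin N → ℝ,
      ∑ e : {e : Fin N × Fin N // e.2 < e.1}, g e.1 =
        ∑ i, ∑ j, if j < i then g (i, j) else 0 := by
    intro g
    rw [← Fintype.sum_prod_type' (fun i j => if j < i then g (i, j) else 0),
      ← Finset.sum_filter, ← Finset.sum_subtype_eq_sum_filter]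
    exact Finset.sum_congr (by ext; simp) fun _ _ => rfl
  have hswap : ∑ i, ∑ j, (if j < i then f j i else 0) =
      ∑ i, ∑ j, if i < j then f i j else 0 := Finset.sum_comm
  have hdiag : ∑ i, f i i = ∑ i, ∑ j, if i = j then f i j else 0 := by simp
  rw [Finset.sum_add_distrib, hsub fun p => f p.1 p.2, hsub fun p => f p.2 p.1, hswap, hdiag]
  simp only [← Finset.sum_add_distrib]
  refine Finset.sum_congr rfl fun i _ => Finset.sum_congr rfl fun j _ => ?_
  rcases lt_trichotomy i j with h | h | h
  · simp [h, h.not_gt, h.ne]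
  · simp [h]
  · simp [h, h.not_gt, h.ne']

/-- **Hoeffding's inequality** for a weighted sum of independent centred random variables with
values in `[0,1]`. -/
theorem measureReal_le_weighted_sum_le {Ω ι : Type*} [MeasurableSpace Ω] [Fintype ι]
    {P : Measure Ω} [IsProbabilityMeasure P] {X : ι → Ω → ℝ}
    (hm : ∀ e, Measurable (X e)) (hX : ∀ e ω, X e ω ∈ Set.Icc (0 : ℝ) 1) (hi : iIndepFun X P)
    (c : ι → ℝ) {V s : ℝ} (hc : ∑ e, c e ^ 2 ≤ V) (hs : 0 < s) :
    P.real {ω | s ≤ ∑ e, c e * (X e ω - P[X e])} ≤ Real.exp (-(2 * s ^ 2 / V)) := by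
  have hsub : ∀ e, HasSubgaussianMGF (fun ω => c e * (X e ω - P[X e]))
      (Real.toNNReal (c e ^ 2 / 4)) P := fun e => by
    convert (hasSubgaussianMGF_of_mem_Icc (μ := P) (hm e).aemeasurable
      (ae_of_all _ (hX e))).const_mul (c e)
    apply NNReal.eq
    rw [Real.coe_toNNReal _ (by positivity)]
    change c e ^ 2 / 4 = c e ^ 2 * (‖(1 : ℝ) - 0‖ / 2) ^ 2
    rw [sub_zero, norm_one]
    ring
  have hi' : iIndepFun (fun e ω => c e * (X e ω - P[X e])) P :=
    hi.comp (fun e x => c e * (x - ∫ ω, X e ω ∂P)) fun e => by fun_prop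
  have key := HasSubgaussianMGF.measure_sum_ge_le_of_iIndepFun hi' (s := Finset.univ)
    (fun e _ => hsub e) hs.le
  have hsum : ((∑ e, Real.toNNReal (c e ^ 2 / 4) : NNReal) : ℝ) = (∑ e, c e ^ 2) / 4 := by
    push_cast
    rw [Finset.sum_div]
    exact Finset.sum_congr rfl fun e _ => max_eq_left (by positivity)
  -- The final comparison divides by `∑ c e ^ 2`; if this vanishes, the sum is `0 < s` and the event
  -- is empty.
  rcases (Finset.sum_nonneg fun e (_ : e ∈ Finset.univ) => sq_nonneg (c e)).eq_or_lt' with h0 | h0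
  · have hc0 : ∀ e, c e = 0 := fun e => by
      simpa using (Finset.sum_eq_zero_iff_of_nonneg fun e _ => sq_nonneg (c e)).1 h0 e
        (Finset.mem_univ e)
    simp [hc0, hs.not_ge, Real.exp_nonneg]
  · refine key.trans (Real.exp_le_exp.2 ?_)
    rw [hsum, neg_div, neg_le_neg_iff]
    calc 2 * s ^ 2 / V ≤ 2 * s ^ 2 / ∑ e, c e ^ 2 := by gcongr
      _ = s ^ 2 / (2 * ((∑ e, c e ^ 2) / 4)) := by field_simp; norm_num

/-- By symmetry the entry below the diagonal at `(i, j)` carries the weight `y i * z j + y j * z i`.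
The squared weights sum to at most `2 * V`, which cancels the `2` in Hoeffding's exponent. -/
theorem measureReal_le_dotProduct_le {Ω : Type*} [MeasurableSpace Ω] {P : Measure Ω}
    [IsProbabilityMeasure P] {W : Graphon} {N : ℕ} {A : Ω → Matrix (Fin N) (Fin N) ℝ}
    (hA : IsRandomAdjacency P W N A) (y z : Fin N → ℝ) {V s : ℝ}
    (hV : (∑ i, y i ^ 2) * ∑ i, z i ^ 2 ≤ V) (hs : 0 < s) :
    P.real {ω | s ≤ y ⬝ᵥ ((A ω - detAdjacency W N) *ᵥ z)} ≤ Real.exp (-(s ^ 2 / V)) := by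
  have hmean : ∀ e : {e : Fin N × Fin N // e.2 < e.1},
      P[fun ω => A ω e.1.1 e.1.2] = detAdjacency W N e.1.1 e.1.2 := by
    rintro ⟨⟨i, j⟩, hij⟩
    have hind : (fun ω => A ω i j) = Set.indicator {ω | A ω i j = 1} fun _ => (1 : ℝ) := by
      ext ω
      rcases hA.zero_or_one ω i j with h | h <;> simp [Set.indicator, h]
    have hms : MeasurableSet {ω | A ω i j = 1} := hA.measurable i j (measurableSet_singleton 1)
    rw [hind, integral_indicator_const _ hms, Measure.real, hA.prob i j hij,
      ENNReal.toReal_ofReal (W.toFun (gridPoint N i) (gridPoint N j)).2.1]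
    simp [detAdjacency, hij.ne']
  have hdetsymm : ∀ i j, detAdjacency W N i j = detAdjacency W N j i := fun i j => by
    simp only [detAdjacency, Matrix.of_apply, W.symm (gridPoint N i), eq_comm (a := i)]
  have hform : ∀ ω, y ⬝ᵥ ((A ω - detAdjacency W N) *ᵥ z) =
      ∑ e : {e : Fin N × Fin N // e.2 < e.1}, (y e.1.1 * z e.1.2 + y e.1.2 * z e.1.1) *
        (A ω e.1.1 e.1.2 - P[fun ω => A ω e.1.1 e.1.2]) := by
    intro ω
    simp only [dotProduct, Matrix.mulVec, Finset.mul_sum]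
    rw [sum_sum_eq_sum_lt_add_sum_diag
      fun i j => y i * ((A ω - detAdjacency W N) i j * z j)]
    rw [Finset.sum_eq_zero (f := fun i => y i * ((A ω - detAdjacency W N) i i * z i)), add_zero]
    · refine Finset.sum_congr rfl fun e _ => ?_
      rw [hmean e, Matrix.sub_apply, Matrix.sub_apply, hA.symm ω e.1.2, hdetsymm e.1.2]
      ring
    · intro i _
      simp [hA.diag, detAdjacency]
  have hcoef : ∑ e : {e : Fin N × Fin N // e.2 < e.1},
      (y e.1.1 * z e.1.2 + y e.1.2 * z e.1.1) ^ 2 ≤ 2 * V := by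
    have hsplit := sum_sum_eq_sum_lt_add_sum_diag fun i j => y i ^ 2 * z j ^ 2
    have hdiag : 0 ≤ ∑ i, y i ^ 2 * z i ^ 2 := Finset.sum_nonneg fun i _ => by positivity
    rw [Finset.sum_mul_sum, hsplit] at hV
    calc _ ≤ ∑ e : {e : Fin N × Fin N // e.2 < e.1},
          2 * (y e.1.1 ^ 2 * z e.1.2 ^ 2 + y e.1.2 ^ 2 * z e.1.1 ^ 2) :=
          Finset.sum_le_sum fun e _ => by
            nlinarith [sq_nonneg (y e.1.1 * z e.1.2 - y e.1.2 * z e.1.1)]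
      _ ≤ 2 * V := by rw [← Finset.mul_sum]; linarith
  have key := measureReal_le_weighted_sum_le (P := P)
    (X := fun (e : {e : Fin N × Fin N // e.2 < e.1}) ω => A ω e.1.1 e.1.2)
    (fun e => hA.measurable _ _)
    (fun e ω => by rcases hA.zero_or_one ω e.1.1 e.1.2 with h | h <;> simp [h])
    hA.indep _ hcoef hs
  simp only [hform]
  convert key using 3
  rw [mul_div_mul_left _ _ two_ne_zero]

/-! ### Nets and the operator norm. -/

/-- The ball of radius `2` of a finite-dimensional normed space has a `1`-net of at most
`5 ^ dim` points. -/
theorem exists_finset_net (E : Type*) [NormedAddCommGroup E] [NormedSpace ℝ E]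
    [FiniteDimensional ℝ E] :
    ∃ S : Finset E, (∀ y ∈ S, ‖y‖ ≤ 2) ∧ S.card ≤ 5 ^ Module.finrank ℝ E ∧
      ∀ x : E, ‖x‖ ≤ 2 → ∃ y ∈ S, ‖x - y‖ ≤ 1 := by
  classical
  -- A `1`-separated set of maximal cardinality is a net: a point far from it could be added. The
  -- packing bound `5 ^ dim` makes the maximum exist.
  let Q : ℕ → Prop := fun n => ∃ S : Finset E, S.card = n ∧ (∀ y ∈ S, ‖y‖ ≤ 2) ∧
    ∀ c ∈ S, ∀ d ∈ S, c ≠ d → 1 ≤ ‖c - d‖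
  have hQ : Q (Nat.findGreatest Q (5 ^ Module.finrank ℝ E)) :=
    Nat.findGreatest_spec (m := 0) (Nat.zero_le _) ⟨∅, by simp⟩
  obtain ⟨S, hcard, hball, hsep⟩ := hQ
  have hle := Besicovitch.card_le_of_separated S hball hsep
  refine ⟨S, hball, hle, fun x hx => ?_⟩
  by_contra! hfar
  have hxS : x ∉ S := fun h => by simpa using (hfar x h).trans_le' zero_le_one
  have hball' : ∀ y ∈ insert x S, ‖y‖ ≤ 2 := by
    simpa [Finset.forall_mem_insert] using ⟨hx, hball⟩
  have hsep' : ∀ c ∈ insert x S, ∀ d ∈ insert x S, c ≠ d → 1 ≤ ‖c - d‖ := by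
    intro c hc d hd hcd
    rcases Finset.mem_insert.1 hc with hcx | hc <;> rcases Finset.mem_insert.1 hd with hdx | hd
    · exact absurd (hcx.trans hdx.symm) hcd
    · exact hcx ▸ (hfar d hd).le
    · rw [hdx, norm_sub_rev]; exact (hfar c hc).le
    · exact hsep c hc d hd hcd
  have hle' := Besicovitch.card_le_of_separated _ hball' hsep'
  have hmax := Nat.le_findGreatest (P := Q) hle' ⟨_, rfl, hball', hsep'⟩
  rw [Finset.card_insert_of_notMem hxS] at hmax
  omega

/-- The operator norm is controlled by the bilinear form on a `1`-net of the ball of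
radius `2`. -/
theorem opNorm_le_of_inner_le_on_net {E : Type*} [NormedAddCommGroup E] [InnerProductSpace ℝ E]
    {S : Finset E} (hS : ∀ x : E, ‖x‖ ≤ 2 → ∃ y ∈ S, ‖x - y‖ ≤ 1) (T : E →L[ℝ] E) {m : ℝ}
    (hT : ∀ y ∈ S, ∀ z ∈ S, inner ℝ y (T z) ≤ m) : ‖T‖ ≤ m := by
  have htwo : ∀ w : E, w ≠ 0 → ‖(2 * ‖w‖⁻¹) • w‖ = 2 := fun w hw => by
    rw [norm_smul, norm_mul, norm_inv, norm_norm, mul_assoc,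
      inv_mul_cancel₀ (norm_ne_zero_iff.2 hw)]
    norm_num
  obtain ⟨y₀, hy₀, -⟩ := hS 0 (by simp)
  have himage : ∀ z ∈ S, ‖T z‖ ≤ m ∨ T z = 0 := by
    intro z hz
    rcases eq_or_ne (T z) 0 with h0 | h0
    · exact Or.inr h0
    left
    -- Here `y` is within `1` of the multiple of `T z` of length `2`, so `⟪y, T z⟫ ≥ 2‖T z‖ - ‖T
    -- z‖`: no constant is lost.
    obtain ⟨y, hy, hxy⟩ := hS _ (htwo _ h0).le
    have h1 : inner ℝ ((2 * ‖T z‖⁻¹) • T z) (T z) = 2 * ‖T z‖ := by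
      rw [real_inner_smul_left, real_inner_self_eq_norm_sq]
      field_simp [norm_ne_zero_iff.2 h0]
    have h2 : inner ℝ ((2 * ‖T z‖⁻¹) • T z - y) (T z) ≤ 1 * ‖T z‖ :=
      (real_inner_le_norm _ _).trans (by gcongr)
    rw [inner_sub_left, h1] at h2
    linarith [hT y hy z hz]
  have hm : 0 ≤ m := by
    rcases himage y₀ hy₀ with h | h
    · exact (norm_nonneg _).trans h
    · simpa [h] using hT y₀ hy₀ y₀ hy₀
  -- Approximating a vector of length `2` gives `2‖T x‖ ≤ m + ‖T‖` for unit `x`; the `‖T‖` on the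
  -- right is then absorbed.
  have hbound : ‖T‖ ≤ (m + ‖T‖) / 2 := by
    refine T.opNorm_le_bound (by positivity) fun x => ?_
    rcases eq_or_ne x 0 with rfl | hx
    · simp
    obtain ⟨y, hy, hxy⟩ := hS _ (htwo x hx).le
    have hTy : ‖T y‖ ≤ m := (himage y hy).elim id fun h => by simpa [h] using hm
    have h1 : ‖T ((2 * ‖x‖⁻¹) • x)‖ ≤ m + ‖T‖ := by
      calc _ = ‖T y + T ((2 * ‖x‖⁻¹) • x - y)‖ := by rw [← map_add, add_sub_cancel]
        _ ≤ ‖T y‖ + ‖T ((2 * ‖x‖⁻¹) • x - y)‖ := norm_add_le _ _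
        _ ≤ m + ‖T‖ * 1 := add_le_add hTy (T.le_opNorm_of_le hxy)
        _ = m + ‖T‖ := by ring
    rw [map_smul, norm_smul, Real.norm_of_nonneg (by positivity)] at h1
    have hx' : 0 < ‖x‖ := norm_pos_iff.2 hx
    calc ‖T x‖ = 2 * ‖x‖⁻¹ * ‖T x‖ * (‖x‖ / 2) := by field_simp
      _ ≤ (m + ‖T‖) * (‖x‖ / 2) := by gcongr
      _ = _ := by ring
  linarith

/-! ### Tail bounds for the adjacency and degree parts. -/

open scoped Matrix.Norms.L2Operator in
theorem opNorm_degMatrix_le {N : ℕ} (B : Matrix (Fin N) (Fin N) ℝ) {m : ℝ} (hm : 0 ≤ m)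
    (h : ∀ i, |∑ j, B i j| ≤ m) : opNorm (degMatrix B) ≤ m := by
  rw [opNorm, ← Matrix.cstar_norm_def, degMatrix, Matrix.l2_opNorm_diagonal]
  exact (pi_norm_le_iff_of_nonneg hm).2 h

theorem opNorm_graphLaplacian_sub_le {N : ℕ} (A B : Matrix (Fin N) (Fin N) ℝ) :
    opNorm (graphLaplacian A - graphLaplacian B) ≤ opNorm (A - B) + opNorm (degMatrix (A - B)) := by
  have : graphLaplacian A - graphLaplacian B = (A - B) - degMatrix (A - B) := by
    have : degMatrix (A - B) = degMatrix A - degMatrix B := by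
      simp [degMatrix, Finset.sum_sub_distrib, Matrix.diagonal_sub]
    rw [this, graphLaplacian, graphLaplacian]
    abel
  rw [this, opNorm, map_sub]
  exact norm_sub_le _ _

/-- Net points have squared norm at most `4`, whence `16 = 4 * 4`. The gap `s < r` is needed because
the net only gives the non-strict bound `opNorm ≤ s`. -/
theorem measureReal_opNorm_adjacency_le {Ω : Type*} [MeasurableSpace Ω] {P : Measure Ω}
    [IsProbabilityMeasure P] {W : Graphon} {N : ℕ} {A : Ω → Matrix (Fin N) (Fin N) ℝ}
    (hA : IsRandomAdjacency P W N A) {s r : ℝ} (hs : 0 < s) (hr : s < r) :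
    P.real {ω | r ≤ opNorm (A ω - detAdjacency W N)} ≤ 25 ^ N * Real.exp (-(s ^ 2 / 16)) := by
  obtain ⟨S, hball, hcard, hnet⟩ := exists_finset_net (EuclideanSpace ℝ (Fin N))
  rw [finrank_euclideanSpace_fin] at hcard
  have hsub : {ω | r ≤ opNorm (A ω - detAdjacency W N)} ⊆
      ⋃ p ∈ S ×ˢ S, {ω | s ≤ p.1.ofLp ⬝ᵥ ((A ω - detAdjacency W N) *ᵥ p.2.ofLp)} := by
    intro ω hω
    by_contra hcon
    simp only [Set.mem_iUnion, Set.mem_ofPred_eq, not_exists, not_le, Finset.mem_product] at hcon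
    refine (hr.trans_le hω).not_ge (opNorm_le_of_inner_le_on_net hnet _ fun y hy z hz => ?_)
    rw [Matrix.inner_toEuclideanCLM]
    exact (hcon (y, z) ⟨hy, hz⟩).le
  have hsq : ∀ y ∈ S, ∑ i, y i ^ 2 ≤ 4 := fun y hy => by
    have := hball y hy
    rw [← EuclideanSpace.real_norm_sq_eq]
    nlinarith [norm_nonneg y]
  calc _ ≤ P.real _ := measureReal_mono hsub (measure_ne_top _ _)
    _ ≤ ∑ p ∈ S ×ˢ S, P.real {ω | s ≤ p.1.ofLp ⬝ᵥ ((A ω - detAdjacency W N) *ᵥ p.2.ofLp)} :=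
        measureReal_biUnion_finset_le _ _
    _ ≤ ∑ p ∈ S ×ˢ S, Real.exp (-(s ^ 2 / 16)) := by
        refine Finset.sum_le_sum fun p hp => measureReal_le_dotProduct_le hA _ _ ?_ hs
        rw [Finset.mem_product] at hp
        have h2 : 0 ≤ ∑ i, p.2 i ^ 2 := Finset.sum_nonneg fun i _ => sq_nonneg _
        nlinarith [hsq p.1 hp.1, hsq p.2 hp.2]
    _ = (S.card * S.card : ℕ) * Real.exp (-(s ^ 2 / 16)) := by
        rw [Finset.sum_const, Finset.card_product, nsmul_eq_mul]
    _ ≤ 25 ^ N * Real.exp (-(s ^ 2 / 16)) := by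
        gcongr
        have : S.card * S.card ≤ 25 ^ N := by
          calc _ ≤ 5 ^ N * 5 ^ N := Nat.mul_le_mul hcard hcard
            _ = 25 ^ N := by rw [← mul_pow]; norm_num
        exact_mod_cast this

theorem measureReal_opNorm_degMatrix_le {Ω : Type*} [MeasurableSpace Ω] {P : Measure Ω}
    [IsProbabilityMeasure P] {W : Graphon} {N : ℕ} {A : Ω → Matrix (Fin N) (Fin N) ℝ}
    (hA : IsRandomAdjacency P W N A) {s r : ℝ} (hs : 0 < s) (hr : s < r) :
    P.real {ω | r ≤ opNorm (degMatrix (A ω - detAdjacency W N))} ≤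
      2 * N * Real.exp (-(s ^ 2 / N)) := by
  -- Row sum `i` times the sign `ε` is the bilinear form at a basis vector and the constant vector
  -- `ε`, so `V = 1 * N`.
  let F : Fin N → ℝ → Set Ω := fun i ε =>
    {ω | s ≤ Pi.single i (1 : ℝ) ⬝ᵥ ((A ω - detAdjacency W N) *ᵥ fun _ => ε)}
  have hF : ∀ i ε, ε ^ 2 = 1 → P.real (F i ε) ≤ Real.exp (-(s ^ 2 / N)) := fun i ε hε =>
    measureReal_le_dotProduct_le hA _ _ (by simp [Pi.single_apply, hε]) hs
  have hsub : {ω | r ≤ opNorm (degMatrix (A ω - detAdjacency W N))} ⊆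
      ⋃ i ∈ (Finset.univ : Finset (Fin N)), (F i 1 ∪ F i (-1)) := by
    intro ω hω
    by_contra hcon
    simp only [Set.mem_iUnion, Finset.mem_univ, not_exists, exists_true_left, Set.mem_union,
      not_or] at hcon
    refine (hr.trans_le hω).not_ge (opNorm_degMatrix_le _ hs.le fun i => ?_)
    have h1 := (hcon i).1
    have h2 := (hcon i).2
    simp only [F, Set.mem_ofPred_eq, not_le, single_one_dotProduct] at h1 h2
    simp only [Matrix.mulVec, dotProduct, mul_one, mul_neg, Finset.sum_neg_distrib] at h1 h2
    exact abs_le.2 ⟨by linarith, h1.le⟩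
  calc _ ≤ P.real _ := measureReal_mono hsub (measure_ne_top _ _)
    _ ≤ ∑ i : Fin N, P.real (F i 1 ∪ F i (-1)) := measureReal_biUnion_finset_le _ _
    _ ≤ ∑ i : Fin N, 2 * Real.exp (-(s ^ 2 / N)) := by
        refine Finset.sum_le_sum fun i _ => (measureReal_union_le _ _).trans ?_
        linarith [hF i 1 (by norm_num), hF i (-1) (by norm_num)]
    _ = 2 * N * Real.exp (-(s ^ 2 / N)) := by
        rw [Finset.sum_const, Finset.card_univ, Fintype.card_fin, nsmul_eq_mul]
        ring

/-! ### Choice of constants and conclusion. -/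

/-- The net bound and the degree bound are absorbed into a single term once `u` is large. -/
theorem union_bound_le {N : ℕ} (hN : 2 ≤ N) {u : ℝ} (hu : 2048 ≤ u) :
    25 ^ N * Real.exp (-(N * u / 256)) + 2 * N * Real.exp (-(u / 16)) ≤
      2 * N * Real.exp (-(1 / 2048) * u) := by
  have hN' : (2 : ℝ) ≤ N := by exact_mod_cast hN
  have he : (25 : ℝ) ≤ Real.exp 4 := by
    have h : (2.7 : ℝ) ≤ Real.exp 1 := by linarith [Real.exp_one_gt_d9]
    calc (25 : ℝ) ≤ 2.7 ^ 4 := by norm_num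
      _ ≤ Real.exp 1 ^ 4 := by gcongr
      _ = Real.exp 4 := by rw [← Real.exp_nat_mul]; norm_num
  -- For `u ≥ 2048`, `4 - u / 256 ≤ -u / 512`, so the exponent absorbs the net's cardinality.
  have h1 : (25 : ℝ) ^ N * Real.exp (-(N * u / 256)) ≤ Real.exp (-(u / 512)) := by
    calc _ ≤ Real.exp 4 ^ N * Real.exp (-(N * u / 256)) := by gcongr
      _ = Real.exp (N * 4 - N * u / 256) := by
        rw [← Real.exp_nat_mul, ← Real.exp_add, sub_eq_add_neg]
      _ ≤ _ := Real.exp_le_exp.2 (by nlinarith)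
  have h2 : Real.exp (-(u / 16)) ≤ Real.exp (-(u / 512)) := Real.exp_le_exp.2 (by linarith)
  have h3 : 2 * Real.exp (-(u / 512)) ≤ Real.exp (-(1 / 2048) * u) := by
    have : (2 : ℝ) ≤ Real.exp 1 := by linarith [Real.exp_one_gt_d9]
    calc _ ≤ Real.exp 1 * Real.exp (-(u / 512)) := by gcongr
      _ = Real.exp (1 - u / 512) := by rw [← Real.exp_add, sub_eq_add_neg]
      _ ≤ _ := Real.exp_le_exp.2 (by linarith)
  have h4 := Real.exp_pos (-(u / 512))
  nlinarith

theorem mainTheorem6 (γ : ℝ) (hγ₀ : 0 < γ) (hγ₁ : γ < 1 / 2) :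
    ∃ C : ℝ, 0 < C ∧
      ∀ (W : Graphon) (N : ℕ), 2 ≤ N →
      ∀ (Ω : Type*) [MeasurableSpace Ω] (P : Measure Ω) [IsProbabilityMeasure P]
        (A : Ω → Matrix (Fin N) (Fin N) ℝ), IsRandomAdjacency P W N A →
        P.real {ω | (N : ℝ) ^ (1 / 2 + γ) ≤
            opNorm (graphLaplacian (A ω) - graphLaplacian (detAdjacency W N))} ≤
          2 * N * Real.exp (-C * (N : ℝ) ^ (2 * γ)) := by

  refine ⟨1 / 2048, by norm_num, fun W N hN Ω _ P _ A hA => ?_⟩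
  have hN' : (2 : ℝ) ≤ N := by exact_mod_cast hN
  have hN0 : (0 : ℝ) < N := by linarith
  -- For `u < 2048` the right-hand side is at least `2 * N * exp (-1) ≥ 1`.
  rcases lt_or_ge ((N : ℝ) ^ (2 * γ)) 2048 with hu | hu
  · have h1 : Real.exp (-1) ≤ Real.exp (-(1 / 2048) * (N : ℝ) ^ (2 * γ)) :=
      Real.exp_le_exp.2 (by linarith)
    have h2 : (1 / 4 : ℝ) ≤ Real.exp (-1) := by linarith [Real.exp_neg_one_gt_d9]
    exact measureReal_le_one.trans (by nlinarith)
  set t : ℝ := (N : ℝ) ^ (1 / 2 + γ) with ht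
  have ht0 : 0 < t := Real.rpow_pos_of_pos hN0 _
  have ht2 : t ^ 2 = N * (N : ℝ) ^ (2 * γ) := by
    rw [ht, ← Real.rpow_natCast, ← Real.rpow_mul hN0.le, ← Real.rpow_one_add' hN0.le (by positivity)]
    congr 1
    push_cast
    ring
  have hsub : {ω | t ≤ opNorm (graphLaplacian (A ω) - graphLaplacian (detAdjacency W N))} ⊆
      {ω | t / 2 ≤ opNorm (A ω - detAdjacency W N)} ∪
        {ω | t / 2 ≤ opNorm (degMatrix (A ω - detAdjacency W N))} := by
    intro ω hω
    by_contra hcon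
    simp only [Set.mem_union, Set.mem_ofPred_eq, not_or, not_le] at hcon hω
    linarith [opNorm_graphLaplacian_sub_le (A ω) (detAdjacency W N)]
  have hadj := measureReal_opNorm_adjacency_le hA (s := t / 4) (r := t / 2) (by linarith)
    (by linarith)
  have hdeg := measureReal_opNorm_degMatrix_le hA (s := t / 4) (r := t / 2) (by linarith)
    (by linarith)
  have e1 : (t / 4) ^ 2 / 16 = N * (N : ℝ) ^ (2 * γ) / 256 := by rw [div_pow, ht2]; ring
  have e2 : (t / 4) ^ 2 / N = (N : ℝ) ^ (2 * γ) / 16 := by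
    rw [div_pow, ht2]; field_simp; norm_num
  rw [e1] at hadj
  rw [e2] at hdeg
  calc _ ≤ P.real _ := measureReal_mono hsub (measure_ne_top _ _)
    _ ≤ _ := measureReal_union_le _ _
    _ ≤ _ := add_le_add hadj hdeg
    _ ≤ _ := union_bound_le hN hu
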